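/- **Setting.** Let $\mathcal A_{\mathbb Z}$ be the quasilocal algebra of the spin-1 chain (one-site algebra $\mathbb M_3$, basis $|{+1}\rangle,|0\rangle,|{-1}\rangle$ of $\mathbb C^3$), and let $S^z=\mathrm{diag}(1,0,-1)$. For $z\in\mathbb R$ let $V_z:\mathbb C^2\to\mathbb C^3\otimes\mathbb C^2$ be the isometry $$V_z|\tfrac12\rangle=\cos z\,|1,-\tfrac12\rangle-\sin z\,|0,\tfrac12\rangle,\qquad V_z|{-\tfrac12}\rangle=\sin z\,|0,-\tfrac12\rangle-\cos z\,|{-1},\tfrac12\rangle ,$$ and for $a\in\mathbb M_3$ let $E_{a,z}(b)=V_z^*(a\otimes b)V_z$ on $\mathbb M_2$. For a sequence $\vec z=(z_j)_{j\in\mathbb Z}$ let $\nu_{\vec z}$ be the unique state on $\mathcal A_{\mathbb Z}$ with $$\nu_{\vec z}(a_m\otimes\cdots\otimes a_n)=\tfrac12\operatorname{tr}\big[E_{a_m,z_m}\circ\cdots\circ E_{a_n,z_n}(\mathbb 1)\big]$$ for all $m\le n$ and $a_m,\dots,a_n\in\mathbb M_3$. **Theorem.** Let $(\Theta_j)_{j\in\mathbb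 Z}$ be independent, identically distributed real random variables on a probability space $(\Omega,\mathbb P)$ with $\Theta_0\in(0,\frac\pi2)\cup(\frac\pi2,\pi)$ almost surely (for instance, $\Theta_0$ with values in $[0,\frac\pi4]$ and $\mathbb P[\Theta_0=0]=0$). Let $\nu_\omega=\nu_{(\Theta_j(\omega))_{j\in\mathbb Z}}$ be the IID disordered AKLT state, and for $L\in\mathbb N$ let $$T_L=\bigotimes_{j=-L}^{L+1}\exp\Big\{-2\pi i\,\frac{j+L}{2L+1}\,S^z_j\Big\}$$ be the Affleck–Lieb twist operator on $[-L,L+1]$. Then $\omega\mapsto\nu_\omega(T_L)$ belongs to $L^1(\mathbb P)$ for every $L$, and $$\lim_{L\to\infty}\mathbb E\,|\nu_\omega(T_L)+1|=0 .$$ Consequently Tasaki's $\mathbb Z_2$ index equals $-1$ in $L^1(\mathbb P)$: the phase $\operatorname{sgn}\nu_\omega(T_L)=\nu_\omega(T_L)/|\nu_\omega(T_L)|$ (read as $0$ where $\nu_\omega(T_L)=0$) belongs to $L^1(\mathbb P)$ for every $L$ and satisfies $\lim_{L\to\infty}\mathbb E\,|\operatorname{sgn}\nu_\omega(T_L)+1|=0$.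 -/

import Mathlib

namespace AKLT

/-- Spin configurations on `ℤ`. The indices `0, 1, 2` of `Fin 3` stand for the spin-1 basis vectors
`|+1⟩, |0⟩, |-1⟩`, in this order. -/
abbrev Config : Type := ℤ → Fin 3

/-- The one-site algebra. -/
abbrev Mat3 : Type := Matrix (Fin 3) (Fin 3) ℂ

/-- Matrices on the bond space; the indices `0, 1` stand for `|+1/2⟩, |-1/2⟩`. -/
abbrev Mat2 : Type := Matrix (Fin 2) (Fin 2) ℂ

/-- The Hilbert space `ℓ²` of spin configurations. Splitting configurations at a finite set `Λ` of
sites gives `ℓ²(Config) = (ℂ³)^{⊗Λ} ⊗ ℓ²(Λᶜ → Fin 3)`, so that the local algebra `M₃^{⊗Λ}` acts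
isometrically, as `a ↦ a ⊗ 1`, and compatibly with the inclusions `Λ ⊆ Λ'`. -/
abbrev ConfigSpace : Type := lp (fun _ : Config => ℂ) 2

/-- The action of the matrix `a` on the spin at the site `x`. -/
def siteFun (x : ℤ) (a : Mat3) (f : Config → ℂ) : Config → ℂ :=
  fun σ => ∑ j, a (σ x) j * f (Function.update σ x j)

/-- Cyclic shift of the spin at the site `x`. -/
def siteShift (x : ℤ) (d : Fin 3) : Config ≃ Config where
  toFun σ := Function.update σ x (σ x + d)
  invFun σ := Function.update σ x (σ x - d)
  left_inv σ := by simp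
  right_inv σ := by simp

theorem siteFun_eq (x : ℤ) (a : Mat3) (f : Config → ℂ) (σ : Config) :
    siteFun x a f σ = ∑ d, a (σ x) (σ x + d) * f (siteShift x d σ) :=
  (Fintype.sum_equiv (Equiv.addLeft (σ x)) _ _ (fun _ => rfl)).symm

theorem entry_bound (a : Mat3) : ∃ C : ℝ, 0 ≤ C ∧ ∀ i j, ‖a i j‖ ≤ C := by
  refine ⟨∑ i, ∑ j, ‖a i j‖, by positivity, fun i j => ?_⟩
  calc ‖a i j‖ ≤ ∑ j, ‖a i j‖ :=
        Finset.single_le_sum (f := fun j => ‖a i j‖) (fun _ _ => norm_nonneg _) (Finset.mem_univ j)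
    _ ≤ _ := Finset.single_le_sum (f := fun i => ∑ j, ‖a i j‖)
        (fun _ _ => by positivity) (Finset.mem_univ i)

theorem two_toReal : (2 : ENNReal).toReal = 2 := by norm_num

theorem summable_shift (x : ℤ) (d : Fin 3) (f : ConfigSpace) :
    Summable fun σ => ‖f (siteShift x d σ)‖ ^ (2 : ENNReal).toReal :=
  (siteShift x d).summable_iff (f := fun σ => ‖f σ‖ ^ (2 : ENNReal).toReal) |>.2
    ((lp.memℓp f).summable (by norm_num))

/-- A bounded function of the spin at `x` times a shifted square summable function. -/
def shiftTerm (x : ℤ) (a : Mat3) (d : Fin 3) (f : Config → ℂ) : Config → ℂ :=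
  fun σ => a (σ x) (σ x + d) * f (siteShift x d σ)

theorem shiftTerm_norm_le {C : ℝ} (hC : 0 ≤ C) {a : Mat3} (ha : ∀ i j, ‖a i j‖ ≤ C)
    (x : ℤ) (d : Fin 3) (f : Config → ℂ) (σ : Config) :
    ‖shiftTerm x a d f σ‖ ^ (2 : ENNReal).toReal
      ≤ C ^ (2 : ENNReal).toReal * ‖f (siteShift x d σ)‖ ^ (2 : ENNReal).toReal := by
  rw [← Real.mul_rpow hC (norm_nonneg _), shiftTerm, norm_mul]
  exact Real.rpow_le_rpow (by positivity)
    (mul_le_mul_of_nonneg_right (ha _ _) (norm_nonneg _)) (by norm_num)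

theorem shiftTerm_mem (x : ℤ) (a : Mat3) (d : Fin 3) (f : ConfigSpace) :
    Memℓp (shiftTerm x a d f) 2 := by
  obtain ⟨C, hC, ha⟩ := entry_bound a
  exact memℓp_gen (Summable.of_nonneg_of_le (fun _ => by positivity)
    (shiftTerm_norm_le hC ha x d f) ((summable_shift x d f).mul_left _))

theorem siteFun_eq_sum (x : ℤ) (a : Mat3) (f : Config → ℂ) :
    siteFun x a f = ∑ d, shiftTerm x a d f := by
  funext σ
  rw [siteFun_eq, Finset.sum_apply]
  rfl

theorem siteFun_mem (x : ℤ) (a : Mat3) (f : ConfigSpace) : Memℓp (siteFun x a f) 2 := by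
  rw [siteFun_eq_sum]
  simp only [Fin.sum_univ_three]
  exact ((shiftTerm_mem x a 0 f).add (shiftTerm_mem x a 1 f)).add (shiftTerm_mem x a 2 f)

theorem shiftTerm_bound {C : ℝ} (hC : 0 ≤ C) {a : Mat3} (ha : ∀ i j, ‖a i j‖ ≤ C)
    (x : ℤ) (d : Fin 3) (f : ConfigSpace) :
    ‖(⟨shiftTerm x a d f, shiftTerm_mem x a d f⟩ : ConfigSpace)‖ ≤ C * ‖f‖ := by
  refine lp.norm_le_of_tsum_le (by norm_num) (by positivity) ?_
  rw [Real.mul_rpow hC (norm_nonneg _), lp.norm_rpow_eq_tsum (by norm_num) f,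
    ← tsum_mul_left, ← (siteShift x d).tsum_eq
      (fun σ => C ^ (2 : ENNReal).toReal * ‖f σ‖ ^ (2 : ENNReal).toReal)]
  exact Summable.tsum_le_tsum (shiftTerm_norm_le hC ha x d f)
    ((shiftTerm_mem x a d f).summable (by norm_num)) ((summable_shift x d f).mul_left _)

/-- The one-site operator as a linear map. -/
def siteLin (x : ℤ) (a : Mat3) : ConfigSpace →ₗ[ℂ] ConfigSpace where
  toFun f := ⟨siteFun x a f, siteFun_mem x a f⟩
  map_add' f g := by
    ext σ
    change siteFun x a (f + g : ConfigSpace) σ = siteFun x a f σ + siteFun x a g σ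
    simp [siteFun, mul_add, Finset.sum_add_distrib]
  map_smul' c f := by
    ext σ
    simp [siteFun, Finset.mul_sum, mul_left_comm]

theorem siteLin_bound (x : ℤ) (a : Mat3) : ∃ C : ℝ, ∀ f, ‖siteLin x a f‖ ≤ C * ‖f‖ := by
  obtain ⟨C, hC, ha⟩ := entry_bound a
  refine ⟨3 * C, fun f => ?_⟩
  have h : siteLin x a f = ∑ d, (⟨shiftTerm x a d f, shiftTerm_mem x a d f⟩ : ConfigSpace) := by
    ext σ
    change siteFun x a f σ = _
    simp only [siteFun_eq_sum, Fin.sum_univ_three]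
    rfl
  rw [h]
  calc _ ≤ ∑ d, ‖(⟨shiftTerm x a d f, shiftTerm_mem x a d f⟩ : ConfigSpace)‖ := norm_sum_le _ _
    _ ≤ ∑ _d : Fin 3, C * ‖f‖ := Finset.sum_le_sum fun d _ => shiftTerm_bound hC ha x d f
    _ = 3 * C * ‖f‖ := by simp; ring

/-- The operator `… ⊗ 1 ⊗ a ⊗ 1 ⊗ …` with `a` at the site `x`. -/
noncomputable def siteOp (x : ℤ) (a : Mat3) : ConfigSpace →L[ℂ] ConfigSpace :=
  (siteLin x a).mkContinuousOfExistsBound (siteLin_bound x a)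

theorem siteOp_apply (x : ℤ) (a : Mat3) (f : ConfigSpace) (σ : Config) :
    siteOp x a f σ = ∑ j, a (σ x) j * f (Function.update σ x j) := rfl

theorem siteOp_one (x : ℤ) : siteOp x 1 = 1 := by
  ext f σ
  simp [siteOp_apply, Matrix.one_apply]

theorem siteOp_mul (x : ℤ) (a b : Mat3) : siteOp x (a * b) = siteOp x a * siteOp x b := by
  ext f σ
  simp only [siteOp_apply, mul_apply_eq_comp, Matrix.mul_apply, Finset.sum_mul,
    Finset.mul_sum, Function.update_self, Function.update_idem]
  rw [Finset.sum_comm]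
  simp [mul_assoc]

theorem siteOp_smul (x : ℤ) (c : ℂ) (a : Mat3) : siteOp x (c • a) = c • siteOp x a := by
  ext f σ
  simp [siteOp_apply, Finset.mul_sum, mul_assoc]

theorem siteOp_commute {x y : ℤ} (h : x ≠ y) (a b : Mat3) :
    siteOp x a * siteOp y b = siteOp y b * siteOp x a := by
  ext f σ
  simp only [siteOp_apply, mul_apply_eq_comp, Finset.mul_sum,
    Function.update_of_ne h.symm, Function.update_of_ne h]
  rw [Finset.sum_comm]
  refine Finset.sum_congr rfl fun i _ => Finset.sum_congr rfl fun j _ => ?_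
  rw [Function.update_comm h]
  ring

theorem siteOp_star (x : ℤ) (a : Mat3) : star (siteOp x a) = siteOp x (star a) := by
  symm
  rw [ContinuousLinearMap.star_eq_adjoint, ContinuousLinearMap.eq_adjoint_iff]
  intro f g
  have key : ∀ (b : Mat3) (u v : ConfigSpace), inner ℂ u (siteOp x b v)
      = ∑ d, ∑' σ : Config, b (σ x) (σ x + d) * v (siteShift x d σ) * star (u σ) := by
    intro b u v
    rw [lp.inner_eq_tsum, ← Summable.tsum_finsetSum]
    · refine tsum_congr fun σ => ?_
      have : siteOp x b v σ = siteFun x b v σ := rfl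
      rw [this, siteFun_eq, RCLike.inner_apply, Finset.sum_mul]
      rfl
    · intro d _
      exact lp.summable_inner u (⟨shiftTerm x b d v, shiftTerm_mem x b d v⟩ : ConfigSpace)
  rw [← inner_conj_symm, key, key, map_sum]
  refine Fintype.sum_equiv (Equiv.neg _) _ _ fun d => ?_
  rw [← (siteShift x d).tsum_eq (fun σ => a (σ x) (σ x + (Equiv.neg (Fin 3)) d) *
    g (siteShift x ((Equiv.neg (Fin 3)) d) σ) * star (f σ)), starRingEnd_apply, tsum_star]
  refine tsum_congr fun σ => ?_
  simp [siteShift, Matrix.star_apply]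
  ring

/-- The quasilocal algebra of the spin-1 chain on `ℤ`: the norm closure of the `*`-algebra generated
by the one-site operators, that is, of the union of the local algebras `M₃^{⊗Λ}` over the finite
subsets `Λ` of `ℤ`. -/
noncomputable def spinChain : StarSubalgebra ℂ (ConfigSpace →L[ℂ] ConfigSpace) :=
  (StarAlgebra.adjoin ℂ {T | ∃ x a, siteOp x a = T}).topologicalClosure

/-- The matrix `a` at the site `x`, as an element of the quasilocal algebra. -/
noncomputable def siteObs (x : ℤ) (a : Mat3) : spinChain :=
  ⟨siteOp x a, StarSubalgebra.le_topologicalClosure _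
    (StarAlgebra.subset_adjoin ℂ _ ⟨x, a, rfl⟩)⟩

/-- `pureTensor a m n = a_m ⊗ a_{m+1} ⊗ ⋯ ⊗ a_{m+n-1}`, the pure tensor of length `n` that starts at
the site `m`. -/
noncomputable def pureTensor (a : ℤ → Mat3) : ℤ → ℕ → spinChain
  | _, 0 => 1
  | m, n + 1 => siteObs m (a m) * pureTensor a (m + 1) n

/-- States of the quasilocal algebra: positive, normalized linear functionals. -/
structure SpinState where
  /-- The functional itself. -/
  toCLM : spinChain →L[ℂ] ℂ
  map_one : toCLM 1 = 1
  nonneg : ∀ b : spinChain, 0 ≤ (toCLM (star b * b)).re ∧ (toCLM (star b * b)).im = 0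

/-- The isometry `V_z : ℂ² → ℂ³ ⊗ ℂ²`,
`V_z |+1/2⟩ = cos z |+1, -1/2⟩ - sin z |0, +1/2⟩` and
`V_z |-1/2⟩ = sin z |0, -1/2⟩ - cos z |-1, +1/2⟩`. -/
noncomputable def akltV (z : ℝ) : Matrix (Fin 3 × Fin 2) (Fin 2) ℂ :=
  Matrix.single (0, 1) 0 (Real.cos z : ℂ) - Matrix.single (1, 0) 0 (Real.sin z : ℂ)
    + Matrix.single (1, 1) 1 (Real.sin z : ℂ) - Matrix.single (2, 0) 1 (Real.cos z : ℂ)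

open scoped Kronecker in
/-- The transfer operator `E_{a,z}(b) = V_z^* (a ⊗ b) V_z`. -/
noncomputable def transfer (a : Mat3) (z : ℝ) (b : Mat2) : Mat2 :=
  (akltV z).conjTranspose * (a ⊗ₖ b) * akltV z

/-- `transferIter z a m n = E_{a_m,z_m} ∘ ⋯ ∘ E_{a_{m+n-1},z_{m+n-1}} (1)`. -/
noncomputable def transferIter (z : ℤ → ℝ) (a : ℤ → Mat3) : ℤ → ℕ → Mat2
  | _, 0 => 1
  | m, n + 1 => transfer (a m) (z m) (transferIter z a (m + 1) n)

/-- `φ` is the state with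
`φ(a_m ⊗ ⋯ ⊗ a_{m+n-1}) = (1/2) tr (E_{a_m,z_m} ∘ ⋯ ∘ E_{a_{m+n-1},z_{m+n-1}} (1))`. -/
def IsAKLTState (z : ℤ → ℝ) (φ : SpinState) : Prop :=
  ∀ (a : ℤ → Mat3) (m : ℤ) (n : ℕ),
    φ.toCLM (pureTensor a m n) = (1 / 2 : ℂ) * (transferIter z a m n).trace

/-! ### Existence and uniqueness of the state -/

/-- The pure tensor as an operator. -/
noncomputable def opTensor (a : ℤ → Mat3) (m : ℤ) (n : ℕ) : ConfigSpace →L[ℂ] ConfigSpace :=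
  (pureTensor a m n : ConfigSpace →L[ℂ] ConfigSpace)

theorem opTensor_zero (a : ℤ → Mat3) (m : ℤ) : opTensor a m 0 = 1 := rfl

theorem opTensor_succ (a : ℤ → Mat3) (m : ℤ) (n : ℕ) :
    opTensor a m (n + 1) = siteOp m (a m) * opTensor a (m + 1) n := rfl

theorem opTensor_congr {a b : ℤ → Mat3} (n : ℕ) : ∀ m : ℤ,
    (∀ x, m ≤ x → x < m + n → a x = b x) → opTensor a m n = opTensor b m n := by
  induction n with
  | zero => intro m _; rfl
  | succ n ih =>
    intro m h
    rw [opTensor_succ, opTensor_succ, h m le_rfl (by push_cast; linarith),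
      ih (m + 1) fun x h1 h2 => h x (by linarith) (by push_cast; linarith)]

theorem transferIter_congr (z : ℤ → ℝ) {a b : ℤ → Mat3} (n : ℕ) : ∀ m : ℤ,
    (∀ x, m ≤ x → x < m + n → a x = b x) → transferIter z a m n = transferIter z b m n := by
  induction n with
  | zero => intro m _; rfl
  | succ n ih =>
    intro m h
    rw [transferIter, transferIter, h m le_rfl (by push_cast; linarith),
      ih (m + 1) fun x h1 h2 => h x (by linarith) (by push_cast; linarith)]

theorem opTensor_commute (a : ℤ → Mat3) (x : ℤ) (c : Mat3) (n : ℕ) : ∀ m : ℤ,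
    (x < m ∨ m + n ≤ x) → siteOp x c * opTensor a m n = opTensor a m n * siteOp x c := by
  induction n with
  | zero => intro m _; simp [opTensor_zero]
  | succ n ih =>
    intro m h
    have hne : x ≠ m := by push_cast at h; omega
    rw [opTensor_succ, ← mul_assoc, siteOp_commute hne, mul_assoc,
      ih (m + 1) (by push_cast at h; omega), mul_assoc]

theorem opTensor_mul (a b : ℤ → Mat3) (n : ℕ) : ∀ m : ℤ,
    opTensor a m n * opTensor b m n = opTensor (a * b) m n := by
  induction n with
  | zero => intro m; simp [opTensor_zero]
  | succ n ih =>
    intro m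
    rw [opTensor_succ, opTensor_succ, opTensor_succ, ← ih, Pi.mul_apply, siteOp_mul,
      mul_assoc, ← mul_assoc _ (siteOp m (b m)),
      ← opTensor_commute a m (b m) n (m + 1) (by left; linarith)]
    simp only [mul_assoc]

theorem opTensor_star (a : ℤ → Mat3) (n : ℕ) : ∀ m : ℤ,
    star (opTensor a m n) = opTensor (star a) m n := by
  induction n with
  | zero => intro m; simp [opTensor_zero]
  | succ n ih =>
    intro m
    rw [opTensor_succ, opTensor_succ, star_mul, ih, siteOp_star, Pi.star_apply,
      opTensor_commute _ _ _ _ _ (by left; linarith)]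

theorem opTensor_one (n : ℕ) : ∀ m : ℤ, opTensor 1 m n = 1 := by
  induction n with
  | zero => intro m; rfl
  | succ n ih =>
    intro m
    rw [opTensor_succ, ih, Pi.one_apply, siteOp_one, one_mul]

theorem opTensor_add (a : ℤ → Mat3) (k n : ℕ) : ∀ m : ℤ,
    opTensor a m (k + n) = opTensor a m k * opTensor a (m + k) n := by
  induction k with
  | zero => intro m; simp [opTensor_zero]
  | succ k ih =>
    intro m
    rw [show k + 1 + n = (k + n) + 1 by ring, opTensor_succ, opTensor_succ, ih, mul_assoc]
    rw [show m + ((k + 1 : ℕ) : ℤ) = m + 1 + (k : ℤ) by push_cast; ring]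

theorem opTensor_mulSingle (x : ℤ) (c : Mat3) (n : ℕ) : ∀ m : ℤ, m ≤ x → x < m + n →
    opTensor (Pi.mulSingle x c) m n = siteOp x c := by
  induction n with
  | zero => intro m h1 h2; simp at h2; omega
  | succ n ih =>
    intro m h1 h2
    rw [opTensor_succ]
    rcases eq_or_lt_of_le h1 with rfl | h
    · rw [Pi.mulSingle_eq_same, opTensor_congr (b := 1) n _ (fun y hy _ =>
        Pi.mulSingle_eq_of_ne (by omega) _), opTensor_one, mul_one]
    · rw [Pi.mulSingle_eq_of_ne (by omega), siteOp_one, one_mul,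
        ih (m + 1) (by omega) (by push_cast at h2; omega)]

/-- The observables supported in `[-N, N]`. -/
noncomputable def localSpan (N : ℕ) : Submodule ℂ (ConfigSpace →L[ℂ] ConfigSpace) :=
  Submodule.span ℂ (Set.range fun a => opTensor a (-(N : ℤ)) (2 * N + 1))

/-- Extension of a pure tensor by identities. -/
noncomputable def pad (a : ℤ → Mat3) (m : ℤ) (n : ℕ) : ℤ → Mat3 :=
  fun x => if m ≤ x ∧ x < m + n then a x else 1

theorem opTensor_pad (a : ℤ → Mat3) (m : ℤ) (n i j : ℕ) :
    opTensor (pad a m n) (m - i) (i + (n + j)) = opTensor a m n := by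
  rw [opTensor_add, opTensor_add, opTensor_congr (b := 1) i, opTensor_one, one_mul,
    opTensor_congr (b := a) n, opTensor_congr (b := 1) j, opTensor_one, mul_one]
  · simp
  · intro x h1 h2
    exact if_neg (by omega)
  · intro x h1 h2
    exact if_pos (by omega)
  · intro x h1 h2
    exact if_neg (by omega)

theorem localSpan_mono {N M : ℕ} (h : N ≤ M) : localSpan N ≤ localSpan M := by
  refine Submodule.span_le.2 ?_
  rintro _ ⟨a, rfl⟩
  obtain ⟨k, rfl⟩ := Nat.exists_eq_add_of_le h
  refine Submodule.subset_span ⟨pad a (-(N : ℤ)) (2 * N + 1), ?_⟩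
  have := opTensor_pad a (-(N : ℤ)) (2 * N + 1) k k
  change opTensor _ _ _ = opTensor _ _ _
  rw [← this]
  congr 1
  · push_cast; ring
  · ring

theorem localSpan_mul {N : ℕ} {b c : ConfigSpace →L[ℂ] ConfigSpace}
    (hb : b ∈ localSpan N) (hc : c ∈ localSpan N) : b * c ∈ localSpan N := by
  have : localSpan N * localSpan N ≤ localSpan N := by
    rw [localSpan, Submodule.span_mul_span]
    refine Submodule.span_mono ?_
    rintro _ ⟨_, ⟨a, rfl⟩, _, ⟨a', rfl⟩, rfl⟩
    exact ⟨a * a', (opTensor_mul a a' _ _).symm⟩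
  exact this (Submodule.mul_mem_mul hb hc)

theorem localSpan_star {N : ℕ} {b : ConfigSpace →L[ℂ] ConfigSpace}
    (hb : b ∈ localSpan N) : star b ∈ localSpan N := by
  induction hb using Submodule.span_induction with
  | mem _ h =>
    obtain ⟨a, rfl⟩ := h
    exact Submodule.subset_span ⟨star a, (opTensor_star a _ _).symm⟩
  | zero => simp
  | add _ _ _ _ h1 h2 => rw [star_add]; exact add_mem h1 h2
  | smul c _ _ h => rw [star_smul]; exact Submodule.smul_mem _ _ h

theorem siteOp_mem_localSpan (x : ℤ) (a : Mat3) : siteOp x a ∈ localSpan x.natAbs :=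
  Submodule.subset_span ⟨Pi.mulSingle x a, opTensor_mulSingle x a _ _ 
    (by rw [Int.natCast_natAbs]; exact neg_abs_le x)
    (by push_cast [Int.natCast_natAbs]; have := le_abs_self x; have := abs_nonneg x; linarith)⟩

theorem adjoin_localSpan {b : ConfigSpace →L[ℂ] ConfigSpace}
    (hb : b ∈ StarAlgebra.adjoin ℂ {T | ∃ x a, siteOp x a = T}) : ∃ N, b ∈ localSpan N := by
  induction hb using StarAlgebra.adjoin_induction with
  | mem b h =>
    obtain ⟨x, a, rfl⟩ := h
    exact ⟨_, siteOp_mem_localSpan x a⟩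
  | algebraMap r =>
    refine ⟨0, ?_⟩
    rw [Algebra.algebraMap_eq_smul_one]
    exact Submodule.smul_mem _ _ (Submodule.subset_span ⟨1, opTensor_one _ _⟩)
  | add b c _ _ hb hc =>
    obtain ⟨N, hN⟩ := hb
    obtain ⟨M, hM⟩ := hc
    exact ⟨max N M, add_mem (localSpan_mono (le_max_left _ _) hN)
      (localSpan_mono (le_max_right _ _) hM)⟩
  | mul b c _ _ hb hc =>
    obtain ⟨N, hN⟩ := hb
    obtain ⟨M, hM⟩ := hc
    exact ⟨max N M, localSpan_mul (localSpan_mono (le_max_left _ _) hN)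
      (localSpan_mono (le_max_right _ _) hM)⟩
  | star b _ hb =>
    obtain ⟨N, hN⟩ := hb
    exact ⟨N, localSpan_star hN⟩

theorem transfer_one_one (z : ℝ) : transfer 1 z 1 = 1 := by
  have h : (Real.cos z : ℂ) * Real.cos z + (Real.sin z : ℂ) * Real.sin z = 1 := by
    have := Complex.cos_sq_add_sin_sq (z : ℂ)
    push_cast
    linear_combination this
  push_cast at h
  ext i j
  fin_cases i <;> fin_cases j <;>
    simp [transfer, akltV, Matrix.mul_apply, Fintype.sum_prod_type, Fin.sum_univ_three,
      Matrix.single_apply, ← Complex.cos_conj, ← Complex.sin_conj, Complex.conj_ofReal] <;>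
    linear_combination h

theorem transfer_one_trace (z : ℝ) (b : Mat2) : (transfer 1 z b).trace = b.trace := by
  have h := Complex.cos_sq_add_sin_sq (z : ℂ)
  simp [transfer, akltV, Matrix.mul_apply, Fintype.sum_prod_type, Fin.sum_univ_three,
    Matrix.single_apply, Matrix.trace, Matrix.one_apply,
    ← Complex.cos_conj, ← Complex.sin_conj, Complex.conj_ofReal]
  linear_combination (b 0 0 + b 1 1) * h

theorem transfer_apply (a : Mat3) (z : ℝ) (b : Mat2) (k k' : Fin 2) :
    transfer a z b k k' = ∑ q, ∑ p, star (akltV z p k) * (a p.1 q.1 * b p.2 q.2) * akltV z q k' := by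
  simp only [transfer, Matrix.mul_apply, Finset.sum_mul, Matrix.conjTranspose_apply,
    Matrix.kroneckerMap_apply]

theorem transferIter_add (z : ℤ → ℝ) (a : ℤ → Mat3) (k : ℕ) : ∀ (m : ℤ) (n : ℕ),
    (∀ x, m + k ≤ x → x < m + k + n → a x = 1) →
      transferIter z a m (k + n) = transferIter z a m k := by
  induction k with
  | zero =>
    intro m n
    induction n generalizing m with
    | zero => intro _; rfl
    | succ n ih =>
      intro h
      have hn := ih (m + 1) fun x h1 h2 => h x (by push_cast at *; linarith)
        (by push_cast at *; linarith)
      rw [Nat.zero_add] at hn ⊢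
      change transfer (a m) (z m) (transferIter z a (m + 1) n) = 1
      rw [hn, h m (by simp) (by push_cast; linarith)]
      exact transfer_one_one _
  | succ k ih =>
    intro m n h
    rw [show k + 1 + n = (k + n) + 1 by ring, transferIter, transferIter, ih (m + 1)]
    intro x h1 h2
    push_cast at *
    exact h x (by linarith) (by linarith)

theorem transferIter_trace (z : ℤ → ℝ) (a : ℤ → Mat3) (k : ℕ) : ∀ (m : ℤ) (n : ℕ),
    (∀ x, m ≤ x → x < m + k → a x = 1) →
      (transferIter z a m (k + n)).trace = (transferIter z a (m + k) n).trace := by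
  induction k with
  | zero => intro m n _; simp
  | succ k ih =>
    intro m n h
    rw [show k + 1 + n = (k + n) + 1 by ring, transferIter, h m le_rfl (by push_cast; linarith),
      transfer_one_trace, ih (m + 1)]
    · rw [show m + ((k + 1 : ℕ) : ℤ) = m + 1 + (k : ℤ) by push_cast; ring]
    · intro x h1 h2
      exact h x (by linarith) (by push_cast; linarith)

theorem transferIter_pad (z : ℤ → ℝ) (a : ℤ → Mat3) (m : ℤ) (n i j : ℕ) :
    (transferIter z (pad a m n) (m - i) (i + (n + j))).trace = (transferIter z a m n).trace := by
  rw [transferIter_trace, sub_add_cancel, transferIter_add, transferIter_congr (b := a)]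
  · intro x h1 h2
    exact if_pos (by omega)
  · intro x h1 h2
    exact if_neg (by omega)
  · intro x h1 h2
    exact if_neg (by omega)

/-- Adds the spin at `x` to a vector with a bond index. -/
noncomputable def addSpin (z : ℝ) (x : ℤ) (ψ : Fin 2 → ConfigSpace) : Fin 2 → ConfigSpace :=
  fun l => ∑ k, ∑ i, akltV z (i, l) k • siteOp x (Matrix.single i 0 1) (ψ k)

/-- The form `∑ B_{ll'} ⟨ψ_l, b ψ_{l'}⟩`. -/
noncomputable def bondForm (B : Mat2) (ψ : Fin 2 → ConfigSpace)
    (b : ConfigSpace →L[ℂ] ConfigSpace) : ℂ :=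
  ∑ l, ∑ l', B l l' * inner ℂ (ψ l) (b (ψ l'))

/-- Adds the spins at `m, …, m + n - 1`. -/
noncomputable def chainVec (z : ℤ → ℝ) : ℤ → ℕ → (Fin 2 → ConfigSpace) → Fin 2 → ConfigSpace
  | _, 0, ψ => ψ
  | m, n + 1, ψ => chainVec z (m + 1) n (addSpin (z m) m ψ)

theorem inner_site (x : ℤ) (i i' : Fin 3) (a : Mat3) (b : ConfigSpace →L[ℂ] ConfigSpace)
    (hb : ∀ c, siteOp x c * b = b * siteOp x c) (u v : ConfigSpace)
    (hv : siteOp x (Matrix.single 0 0 1) v = v) :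
    inner ℂ (siteOp x (Matrix.single i 0 1) u)
      ((b * siteOp x a) (siteOp x (Matrix.single i' 0 1) v)) = a i i' * inner ℂ u (b v) := by
  have h1 : siteOp x (Matrix.single i 0 1) = star (siteOp x (Matrix.single 0 i 1)) := by
    rw [siteOp_star, Matrix.star_eq_conjTranspose, Matrix.conjTranspose_single, star_one]
  rw [h1, ContinuousLinearMap.star_eq_adjoint, ContinuousLinearMap.adjoint_inner_left,
    ← mul_apply_eq_comp, ← mul_apply_eq_comp, mul_assoc]
  have h2 : siteOp x (Matrix.single 0 i 1) * (b * siteOp x a * siteOp x (Matrix.single i' 0 1))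
      = a i i' • (b * siteOp x (Matrix.single 0 0 1)) := by
    rw [← mul_assoc, ← mul_assoc, hb, mul_assoc, mul_assoc, ← siteOp_mul, ← siteOp_mul,
      ← mul_smul_comm, ← siteOp_smul, ← mul_assoc]
    congr 2
    ext p q
    simp [Matrix.single_mul_mul_single, Matrix.single_apply]
  rw [h2]
  simp [hv, inner_smul_right]

theorem bondForm_addSpin (z : ℝ) (x : ℤ) (a : Mat3) (B : Mat2) (ψ : Fin 2 → ConfigSpace)
    (b : ConfigSpace →L[ℂ] ConfigSpace) (hb : ∀ c, siteOp x c * b = b * siteOp x c)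
    (hψ : ∀ k, siteOp x (Matrix.single 0 0 1) (ψ k) = ψ k) :
    bondForm B (addSpin z x ψ) (b * siteOp x a) = bondForm (transfer a z B) ψ b := by
  have h : ∀ l l', B l l' * inner ℂ (addSpin z x ψ l) ((b * siteOp x a) (addSpin z x ψ l'))
      = ∑ k, ∑ k', ∑ i, ∑ i', star (akltV z (i, l) k) * (a i i' * B l l') * akltV z (i', l') k' *
        inner ℂ (ψ k) (b (ψ k')) := by
    intro l l'
    simp only [addSpin, map_sum, sum_inner, inner_sum, map_smul, inner_smul_left, inner_smul_right,
      inner_site x _ _ a b hb _ _ (hψ _), starRingEnd_apply]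
    simp only [Fin.sum_univ_two, Fin.sum_univ_three]
    ring
  simp only [bondForm, h, transfer_apply, Fintype.sum_prod_type,
    Fin.sum_univ_two, Fin.sum_univ_three]
  ring

theorem bondForm_chainVec (z : ℤ → ℝ) (a : ℤ → Mat3) (n : ℕ) :
    ∀ (m : ℤ) (ψ : Fin 2 → ConfigSpace) (b : ConfigSpace →L[ℂ] ConfigSpace),
      (∀ x, m ≤ x → x < m + n → ∀ c, siteOp x c * b = b * siteOp x c) →
      (∀ x, m ≤ x → x < m + n → ∀ k, siteOp x (Matrix.single 0 0 1) (ψ k) = ψ k) →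
      bondForm 1 (chainVec z m n ψ) (b * opTensor a m n)
        = bondForm (transferIter z a m n) ψ b := by
  induction n with
  | zero => intro m ψ b _ _; simp [opTensor_zero, chainVec, transferIter]
  | succ n ih =>
    intro m ψ b hb hψ
    rw [chainVec, opTensor_succ, ← mul_assoc, ih (m + 1), transferIter,
      bondForm_addSpin _ _ _ _ _ _ (hb m le_rfl (by push_cast; linarith))
        (hψ m le_rfl (by push_cast; linarith))]
    · intro x h1 h2 c
      rw [← mul_assoc, hb x (by linarith) (by push_cast; linarith), mul_assoc, mul_assoc,
        siteOp_commute (by omega)]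
    · intro x h1 h2 k
      simp only [addSpin, map_sum, map_smul]
      refine Finset.sum_congr rfl fun k' _ => Finset.sum_congr rfl fun i _ => ?_
      rw [← mul_apply_eq_comp, siteOp_commute (by omega),
        mul_apply_eq_comp, hψ x (by linarith) (by push_cast; linarith)]

open scoped Classical in
/-- The configuration with the index `0` everywhere, as a unit vector. -/
noncomputable def vacuum : ConfigSpace := lp.single 2 (fun _ => 0) 1

open scoped Classical in
theorem vacuum_apply (σ : Config) : vacuum σ = if σ = (fun _ => 0) then 1 else 0 := by
  rw [vacuum, lp.coeFn_single, Pi.single_apply]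

theorem vacuum_proj (x : ℤ) : siteOp x (Matrix.single 0 0 1) vacuum = vacuum := by
  ext σ
  rw [siteOp_apply]
  by_cases h : σ x = 0
  · have : Function.update σ x 0 = σ := by rw [← h, Function.update_eq_self]
    simp [Matrix.single_apply, h, this]
  · have h2 : σ ≠ fun _ => 0 := fun h' => h (by rw [h'])
    simp [Ne.symm h, vacuum_apply, h2]

open scoped Classical in
theorem vacuum_norm : ‖vacuum‖ = 1 := by
  rw [vacuum, lp.norm_single (by norm_num), norm_one]

/-- The finite volume functional. -/
noncomputable def volState (z : ℤ → ℝ) (N : ℕ) (b : ConfigSpace →L[ℂ] ConfigSpace) : ℂ :=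
  (1 / 2) * ∑ k, bondForm 1 (chainVec z (-(N : ℤ)) (2 * N + 1) (Pi.single k vacuum)) b

theorem volState_opTensor (z : ℤ → ℝ) (N : ℕ) (a : ℤ → Mat3) :
    volState z N (opTensor a (-(N : ℤ)) (2 * N + 1))
      = (1 / 2) * (transferIter z a (-(N : ℤ)) (2 * N + 1)).trace := by
  rw [volState, Matrix.trace]
  congr 1
  refine Finset.sum_congr rfl fun k _ => ?_
  rw [← one_mul (opTensor _ _ _), bondForm_chainVec]
  · fin_cases k <;> simp [bondForm, vacuum_norm]
  · intro x _ _ c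
    simp
  · intro x _ _ j
    by_cases h : j = k
    · subst h
      simp [vacuum_proj]
    · simp [h]

theorem transferIter_one (z : ℤ → ℝ) (m : ℤ) (n : ℕ) : transferIter z 1 m n = 1 := by
  have := transferIter_add z 1 0 m n (fun _ _ _ => rfl)
  rwa [Nat.zero_add] at this

theorem volState_eq (z : ℤ → ℝ) (N : ℕ) (b : ConfigSpace →L[ℂ] ConfigSpace) :
    volState z N b = (1 / 2) * ∑ k, ∑ l,
      inner ℂ (chainVec z (-(N : ℤ)) (2 * N + 1) (Pi.single k vacuum) l)
        (b (chainVec z (-(N : ℤ)) (2 * N + 1) (Pi.single k vacuum) l)) := by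
  rw [volState]
  congr 1
  refine Finset.sum_congr rfl fun k _ => ?_
  simp [bondForm, Matrix.one_apply]

theorem volState_one (z : ℤ → ℝ) (N : ℕ) : volState z N 1 = 1 := by
  rw [← opTensor_one (2 * N + 1) (-(N : ℤ)), volState_opTensor, transferIter_one]
  simp

theorem volState_norm_sum (z : ℤ → ℝ) (N : ℕ) : (1 / 2 : ℝ) * ∑ k, ∑ l,
    ‖chainVec z (-(N : ℤ)) (2 * N + 1) (Pi.single k vacuum) l‖ ^ 2 = 1 := by
  have h := volState_one z N
  rw [volState_eq] at h
  simp only [one_apply_eq_self, inner_self_eq_norm_sq_to_K] at h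
  apply Complex.ofReal_injective
  push_cast
  exact h

theorem volState_bound (z : ℤ → ℝ) (N : ℕ) (b : ConfigSpace →L[ℂ] ConfigSpace) :
    ‖volState z N b‖ ≤ 1 * ‖b‖ := by
  rw [← volState_norm_sum z N, volState_eq, norm_mul, mul_assoc, Finset.sum_mul]
  simp only [Finset.sum_mul]
  refine mul_le_mul (by simp) ?_ (norm_nonneg _) (by norm_num)
  refine (norm_sum_le _ _).trans (Finset.sum_le_sum fun k _ => ?_)
  refine (norm_sum_le _ _).trans (Finset.sum_le_sum fun l _ => ?_)
  refine (norm_inner_le_norm _ _).trans ?_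
  rw [pow_two, mul_assoc, mul_comm _ ‖b‖]
  exact mul_le_mul_of_nonneg_left (b.le_opNorm _) (norm_nonneg _)

theorem volState_nonneg (z : ℤ → ℝ) (N : ℕ) (b : ConfigSpace →L[ℂ] ConfigSpace) :
    0 ≤ (volState z N (star b * b)).re ∧ (volState z N (star b * b)).im = 0 := by
  have h : volState z N (star b * b) = ((1 / 2 * ∑ k, ∑ l,
      ‖b (chainVec z (-(N : ℤ)) (2 * N + 1) (Pi.single k vacuum) l)‖ ^ 2 : ℝ) : ℂ) := by
    rw [volState_eq]
    simp only [mul_apply_eq_comp, ContinuousLinearMap.star_eq_adjoint,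
      ContinuousLinearMap.adjoint_inner_right, inner_self_eq_norm_sq_to_K]
    push_cast
    rfl
  rw [h]
  exact ⟨by rw [Complex.ofReal_re]; positivity, Complex.ofReal_im _⟩

/-- The finite volume functional as a continuous linear map. -/
noncomputable def volLin (z : ℤ → ℝ) (N : ℕ) : (ConfigSpace →L[ℂ] ConfigSpace) →L[ℂ] ℂ :=
  LinearMap.mkContinuous
    { toFun := volState z N
      map_add' := fun b c => by
        simp only [volState_eq, add_apply, inner_add_right,
          Finset.sum_add_distrib, mul_add]
      map_smul' := fun r b => by
        simp only [volState_eq, smul_apply, inner_smul_right,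
          ← Finset.mul_sum, RingHom.id_apply, smul_eq_mul]
        ring } 1 (volState_bound z N)

theorem volLin_apply (z : ℤ → ℝ) (N : ℕ) (b : ConfigSpace →L[ℂ] ConfigSpace) :
    volLin z N b = volState z N b := rfl

theorem volLin_opTensor (z : ℤ → ℝ) (a : ℤ → Mat3) (m : ℤ) (n N : ℕ) (h1 : -(N : ℤ) ≤ m)
    (h2 : m + n ≤ N + 1) :
    volLin z N (opTensor a m n) = (1 / 2) * (transferIter z a m n).trace := by
  obtain ⟨i, hi⟩ := Int.eq_ofNat_of_zero_le (show 0 ≤ m + N by linarith)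
  obtain ⟨j, hj⟩ := Int.eq_ofNat_of_zero_le (show 0 ≤ (N : ℤ) + 1 - (m + n) by linarith)
  have e1 : -(N : ℤ) = m - i := by linarith
  have e2 : 2 * N + 1 = i + (n + j) := by omega
  have := volState_opTensor z N (pad a m n)
  rw [e1, e2, opTensor_pad, transferIter_pad] at this
  exact this

theorem volLin_local (z : ℤ → ℝ) {N : ℕ} {b : ConfigSpace →L[ℂ] ConfigSpace}
    (hb : b ∈ localSpan N) {M : ℕ} (h : N ≤ M) : volLin z M b = volLin z N b := by
  induction hb using Submodule.span_induction with
  | mem _ h' =>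
    obtain ⟨a, rfl⟩ := h'
    rw [volLin_opTensor z a _ _ M (by omega) (by push_cast; omega),
      volLin_opTensor z a _ _ N (by omega) (by push_cast; omega)]
  | zero => simp
  | add _ _ _ _ h1 h2 => rw [map_add, map_add, h1, h2]
  | smul c _ _ h => rw [map_smul, map_smul, h]

theorem mem_spinChain_approx (b : spinChain) {ε : ℝ} (hε : 0 < ε) :
    ∃ N, ∃ c ∈ localSpan N, ‖(b : ConfigSpace →L[ℂ] ConfigSpace) - c‖ < ε := by
  have hb := b.2
  change (b : ConfigSpace →L[ℂ] ConfigSpace) ∈ closure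
    (StarAlgebra.adjoin ℂ {T | ∃ x a, siteOp x a = T} : Set _) at hb
  rw [Metric.mem_closure_iff] at hb
  obtain ⟨c, hc, h⟩ := hb ε hε
  obtain ⟨N, hN⟩ := adjoin_localSpan hc
  exact ⟨N, c, hN, by rwa [← dist_eq_norm]⟩

theorem volLin_cauchy (z : ℤ → ℝ) (b : spinChain) :
    CauchySeq fun N => volLin z N (b : ConfigSpace →L[ℂ] ConfigSpace) := by
  rw [Metric.cauchySeq_iff']
  intro ε hε
  obtain ⟨N, c, hc, h⟩ := mem_spinChain_approx b (half_pos hε)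
  refine ⟨N, fun M hM => ?_⟩
  have e : volLin z M (b : ConfigSpace →L[ℂ] ConfigSpace) - volLin z N b
      = volLin z M (b - c) - volLin z N (b - c) := by
    rw [map_sub, map_sub, volLin_local z hc hM]
    ring
  rw [dist_eq_norm, e]
  have h1 := volState_bound z M ((b : ConfigSpace →L[ℂ] ConfigSpace) - c)
  have h2 := volState_bound z N ((b : ConfigSpace →L[ℂ] ConfigSpace) - c)
  calc _ ≤ ‖volLin z M (b - c)‖ + ‖volLin z N (b - c)‖ := norm_sub_le _ _
    _ < ε := by rw [volLin_apply, volLin_apply]; linarith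

instance : CompleteSpace spinChain :=
  (StarSubalgebra.isClosed_topologicalClosure _).completeSpace_coe

theorem exists_akltState (z : ℤ → ℝ) : ∃ φ : SpinState, IsAKLTState z φ := by
  choose f hf using fun b : spinChain => cauchySeq_tendsto_of_complete (volLin_cauchy z b)
  let g : ℕ → spinChain →L[ℂ] ℂ := fun N =>
    (volLin z N).comp (spinChain.toSubalgebra.toSubmodule.subtypeL)
  have hg : Filter.Tendsto (fun N b => g N b) Filter.atTop (nhds f) :=
    tendsto_pi_nhds.2 fun b => hf b
  let F : spinChain →L[ℂ] ℂ := continuousLinearMapOfTendsto g hg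
  refine ⟨⟨F, ?_, ?_⟩, ?_⟩
  · refine tendsto_nhds_unique (hf 1) ?_
    refine tendsto_const_nhds.congr fun N => ?_
    exact (volState_one z N).symm
  · intro b
    constructor
    · exact ge_of_tendsto' ((Complex.continuous_re.tendsto _).comp (hf (star b * b)))
        fun N => (volState_nonneg z N b).1
    · refine tendsto_nhds_unique ((Complex.continuous_im.tendsto _).comp (hf (star b * b))) ?_
      refine tendsto_const_nhds.congr fun N => ?_
      exact (volState_nonneg z N b).2.symm
  · intro a m n
    refine tendsto_nhds_unique (hf (pureTensor a m n)) ?_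
    refine tendsto_const_nhds.congr' ?_
    filter_upwards [Filter.eventually_ge_atTop (m.natAbs + n)] with N hN
    exact (volLin_opTensor z a m n N (by omega) (by omega)).symm

theorem akltState_unique (z : ℤ → ℝ) {φ ψ : SpinState} (hφ : IsAKLTState z φ)
    (hψ : IsAKLTState z ψ) : φ = ψ := by
  have hloc : ∀ (N : ℕ) (c : ConfigSpace →L[ℂ] ConfigSpace), c ∈ localSpan N →
      ∃ hc : c ∈ spinChain, φ.toCLM ⟨c, hc⟩ = ψ.toCLM ⟨c, hc⟩ := by
    intro N c hc
    induction hc using Submodule.span_induction with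
    | mem _ h =>
      obtain ⟨a, rfl⟩ := h
      exact ⟨(pureTensor a (-(N : ℤ)) (2 * N + 1)).2, (hφ a _ _).trans (hψ a _ _).symm⟩
    | zero => exact ⟨zero_mem _, (map_zero φ.toCLM).trans (map_zero ψ.toCLM).symm⟩
    | add b c _ _ h1 h2 =>
      obtain ⟨hb, eb⟩ := h1
      obtain ⟨hc, ec⟩ := h2
      refine ⟨add_mem hb hc, ?_⟩
      have := congrArg₂ (· + ·) eb ec
      simp only [← map_add] at this
      exact this
    | smul r b _ h =>
      obtain ⟨hb, eb⟩ := h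
      refine ⟨SMulMemClass.smul_mem r hb, ?_⟩
      have := congrArg (r • ·) eb
      simp only [← map_smul] at this
      exact this
  have hcl : IsClosed {b : spinChain | φ.toCLM b = ψ.toCLM b} :=
    isClosed_eq φ.toCLM.continuous ψ.toCLM.continuous
  have heq : φ.toCLM = ψ.toCLM := by
    ext b
    change b ∈ {b : spinChain | φ.toCLM b = ψ.toCLM b}
    rw [← hcl.closure_eq, Metric.mem_closure_iff]
    intro ε hε
    obtain ⟨N, c, hc, h⟩ := mem_spinChain_approx b hε
    obtain ⟨hc', e⟩ := hloc N c hc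
    exact ⟨⟨c, hc'⟩, e, by rw [Subtype.dist_eq, dist_eq_norm]; exact h⟩
  cases φ
  cases ψ
  congr

/-- The bulk state `ν_z` of the sequence of angles `z`. -/
noncomputable def akltState (z : ℤ → ℝ) : SpinState := (exists_akltState z).choose

theorem akltState_pureTensor (z : ℤ → ℝ) (a : ℤ → Mat3) (m : ℤ) (n : ℕ) :
    (akltState z).toCLM (pureTensor a m n) = (1 / 2 : ℂ) * (transferIter z a m n).trace :=
  (exists_akltState z).choose_spec a m n

/-! ### The twist operator -/

/-- The spin-1 matrix `S^z`. -/
def spinZ : Mat3 := Matrix.diagonal ![1, 0, -1]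

/-- The Affleck-Lieb twist operator
`T_L = ⨂_{j = -L}^{L+1} exp (-2πi ((j + L) / (2L + 1)) S^z_j)`. -/
noncomputable def twist (L : ℕ) : spinChain :=
  pureTensor (fun j => NormedSpace.exp
    ((-(2 * Real.pi * Complex.I * (((j : ℂ) + L) / (2 * L + 1)))) • spinZ)) (-(L : ℤ)) (2 * L + 2)

/-- The phase (sign) `φ(T_L) / |φ(T_L)|`, with the value `0` if `φ(T_L) = 0`. -/
noncomputable def twistSign (φ : SpinState) (L : ℕ) : ℂ :=
  φ.toCLM (twist L) / (‖φ.toCLM (twist L)‖ : ℂ)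

end AKLT

namespace AKLT
open Complex

/-! The twist at a site is diagonal in the `S^z` basis, so the twisted transfer operator maps the
two diagonal entries `x`, `y` of a bond matrix to `sin² z · x + cos² z · e^{-iθ} y` and `sin² z · y
+ cos² z · e^{iθ} x`. After the gauge change `x ↦ e^{iθ/2} x`, `y ↦ e^{-iθ/2} y` this is the real
matrix with rows `(sin² z, cos² z)` and `(cos² z, sin² z)`: it fixes the symmetric combination and
multiplies the antisymmetric one by `-cos 2z`. The angles of neighbouring sites differ by `δ = 2π /
(2L + 1)`, so passing from one gauge to the next rotates the two combinations into each other by the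
small angle `δ/2` (`symPart_succ`, `antiPart_succ`).

The range of `Θ_0` excludes the angles with `|cos 2z| = 1`, so `ρ = 𝔼|cos 2Θ_0| < 1`. Together with
independence this keeps the mean of the antisymmetric part at `O(δ)`
(`lintegral_prod_mul_antiPart_le`). The symmetric part then moves in mean by only `O(δ²)` per site
(`lintegral_symPart_sub_le`), hence by `O(Lδ²) = O(1/L)` along the whole chain.

At the left end the angle is `0`, and the symmetric part is `ν(T_L)`. At the right end, where no
transfer operator has acted yet, it is the cosine of half the gauge angle; that half angle is `π +
δ/2`, because the twist has made a full turn. The value `-cos(δ/2)` tends to `-1`. The statement on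
the phase follows from `norm_phase_add_one_le`. -/

/-! ### The twisted transfer operator on diagonal entries -/

/-- The one-site matrix `exp (-iθ S^z)`. -/
noncomputable def phaseObs (θ : ℝ) : Mat3 :=
  Matrix.diagonal ![cexp (-(θ * I)), 1, cexp (θ * I)]

theorem exp_smul_spinZ (θ : ℝ) : NormedSpace.exp ((-(θ * I) : ℂ) • spinZ) = phaseObs θ := by
  rw [spinZ, ← Matrix.diagonal_smul, Matrix.exp_diagonal, phaseObs]
  congr 1
  funext i
  rw [Pi.coe_exp, ← Complex.exp_eq_exp_ℂ]
  fin_cases i <;> simp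

/-- Spin 0 keeps the bond state (weight `sin² z`), and spin ±1 flips it (weight `cos² z`). A
diagonal observable therefore never mixes off-diagonal entries of `b` into the diagonal. -/
theorem transfer_phaseObs_zero_zero (θ z : ℝ) (b : Mat2) :
    transfer (phaseObs θ) z b 0 0
      = Real.sin z ^ 2 * b 0 0 + Real.cos z ^ 2 * (cexp (-(θ * I)) * b 1 1) := by
  simp [transfer, akltV, phaseObs, Matrix.mul_apply, Fintype.sum_prod_type, Fin.sum_univ_three,
    Matrix.single_apply, Matrix.diagonal_apply, -ofReal_sin, -ofReal_cos]
  ring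

theorem transfer_phaseObs_one_one (θ z : ℝ) (b : Mat2) :
    transfer (phaseObs θ) z b 1 1
      = Real.sin z ^ 2 * b 1 1 + Real.cos z ^ 2 * (cexp (θ * I) * b 0 0) := by
  simp [transfer, akltV, phaseObs, Matrix.mul_apply, Fintype.sum_prod_type, Fin.sum_univ_three,
    Matrix.single_apply, Matrix.diagonal_apply, -ofReal_sin, -ofReal_cos]
  ring

/-- The diagonal entries of a twisted transfer product are averages of phases. -/
theorem transferIter_phaseObs_norm_le (z θ : ℤ → ℝ) (n : ℕ) : ∀ m : ℤ,
    ‖transferIter z (fun j => phaseObs (θ j)) m n 0 0‖ ≤ 1 ∧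
      ‖transferIter z (fun j => phaseObs (θ j)) m n 1 1‖ ≤ 1 := by
  have key : ∀ (x t : ℝ) (u v : ℂ), ‖u‖ ≤ 1 → ‖v‖ ≤ 1 →
      ‖(Real.sin x : ℂ) ^ 2 * u + (Real.cos x : ℂ) ^ 2 * (cexp (t * I) * v)‖ ≤ 1 := by
    intro x t u v hu hv
    refine (norm_add_le _ _).trans ?_
    rw [norm_mul, norm_mul, norm_mul, norm_exp_ofReal_mul_I, one_mul, norm_pow, norm_pow,
      norm_real, norm_real, Real.norm_eq_abs, Real.norm_eq_abs, sq_abs, sq_abs]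
    nlinarith [Real.sin_sq_add_cos_sq x, sq_nonneg (Real.sin x), sq_nonneg (Real.cos x)]
  induction n with
  | zero => intro m; simp [transferIter]
  | succ n ih =>
    intro m
    obtain ⟨h0, h1⟩ := ih (m + 1)
    simp only [transferIter, transfer_phaseObs_zero_zero, transfer_phaseObs_one_one]
    refine ⟨?_, key _ _ _ _ h1 h0⟩
    have := key (z m) (-θ m) _ _ h0 h1
    simpa only [ofReal_neg, neg_mul] using this

/-! ### Symmetric and antisymmetric parts, and their recursion -/

/-- The symmetric part of the diagonal of a twisted transfer product, in the gauge in which the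
phases at the two bond states are opposite. -/
noncomputable def symPart (z θ : ℤ → ℝ) (m : ℤ) (n : ℕ) : ℂ :=
  (cexp ((θ m / 2 : ℝ) * I) * transferIter z (fun j => phaseObs (θ j)) m n 0 0
    + cexp (-((θ m / 2 : ℝ) * I)) * transferIter z (fun j => phaseObs (θ j)) m n 1 1) / 2

/-- The antisymmetric counterpart of `symPart`. -/
noncomputable def antiPart (z θ : ℤ → ℝ) (m : ℤ) (n : ℕ) : ℂ :=
  (cexp ((θ m / 2 : ℝ) * I) * transferIter z (fun j => phaseObs (θ j)) m n 0 0
    - cexp (-((θ m / 2 : ℝ) * I)) * transferIter z (fun j => phaseObs (θ j)) m n 1 1) / 2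

theorem symPart_norm_le (z θ : ℤ → ℝ) (m : ℤ) (n : ℕ) : ‖symPart z θ m n‖ ≤ 1 := by
  obtain ⟨h0, h1⟩ := transferIter_phaseObs_norm_le z θ n m
  rw [symPart, norm_div, ← neg_mul, ← ofReal_neg]
  have := norm_add_le (cexp ((θ m / 2 : ℝ) * I) * transferIter z (fun j => phaseObs (θ j)) m n 0 0)
    (cexp ((-(θ m / 2) : ℝ) * I) * transferIter z (fun j => phaseObs (θ j)) m n 1 1)
  rw [norm_mul, norm_mul, norm_exp_ofReal_mul_I, norm_exp_ofReal_mul_I] at this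
  rw [Complex.norm_ofNat]
  linarith

/-- With `X` and `Y` the entries in the gauge `t + d`, the right side is `e^{-id} X + e^{id} Y`;
expanding by Euler's formula gives the rotation of `X + Y` and `X - Y` by the angle `d`. -/
theorem cos_sub_I_mul_sin_gauge (t d x y : ℂ) :
    Complex.cos d * (cexp ((t + d) * I) * x + cexp (-((t + d) * I)) * y)
        - I * Complex.sin d * (cexp ((t + d) * I) * x - cexp (-((t + d) * I)) * y)
      = cexp (t * I) * x + cexp (-(t * I)) * y := by
  have e : cexp (d * I) * cexp (-(d * I)) = 1 := by rw [← exp_add, add_neg_cancel, exp_zero]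
  rw [Complex.cos, Complex.sin, add_mul, neg_add, exp_add, exp_add, neg_mul]
  linear_combination (cexp (t * I) * x + cexp (-(t * I)) * y) * e
    + (cexp (d * I) - cexp (-(d * I))) / 2 * (cexp (t * I) * cexp (d * I) * x
      - cexp (-(t * I)) * cexp (-(d * I)) * y) * I_sq

theorem cos_sub_I_mul_sin_gauge' (t d x y : ℂ) :
    Complex.cos d * (cexp ((t + d) * I) * x - cexp (-((t + d) * I)) * y)
        - I * Complex.sin d * (cexp ((t + d) * I) * x + cexp (-((t + d) * I)) * y)
      = cexp (t * I) * x - cexp (-(t * I)) * y := by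
  have := cos_sub_I_mul_sin_gauge t d x (-y)
  simpa only [mul_neg, ← sub_eq_add_neg, sub_neg_eq_add] using this

/-- The half-angle gauge absorbs the phase that comes with a bond flip: the flipped entry reappears
with exactly the gauge factor of its own bond state. -/
theorem exp_gauge (t u : ℂ) : cexp (t / 2 * I) * (cexp (-(t * I)) * u) = cexp (-(t / 2 * I)) * u := by
  rw [← mul_assoc, ← exp_add]
  ring_nf

theorem exp_gauge' (t u : ℂ) : cexp (-(t / 2 * I)) * (cexp (t * I) * u) = cexp (t / 2 * I) * u := by
  rw [← mul_assoc, ← exp_add]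
  ring_nf

/-- The symmetric vector has eigenvalue `sin² + cos² = 1` under the site at `m`, so the angle `z m`
drops out and only the rotation from the gauge `θ (m + 1)` to the gauge `θ m` remains. -/
theorem symPart_succ (z θ : ℤ → ℝ) (δ : ℝ) (m : ℤ) (n : ℕ) (h : θ (m + 1) = θ m + δ) :
    symPart z θ m (n + 1) = Real.cos (δ / 2) * symPart z θ (m + 1) n
      - I * Real.sin (δ / 2) * antiPart z θ (m + 1) n := by
  simp only [symPart, antiPart, transferIter, transfer_phaseObs_zero_zero,
    transfer_phaseObs_one_one, h]
  generalize transferIter z (fun j => phaseObs (θ j)) (m + 1) n 0 0 = x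
  generalize transferIter z (fun j => phaseObs (θ j)) (m + 1) n 1 1 = y
  push_cast
  rw [add_div (θ m : ℂ)]
  linear_combination -(cos_sub_I_mul_sin_gauge (θ m / 2) (δ / 2) x y) / 2
    + Complex.cos (z m) ^ 2 / 2 * (exp_gauge (θ m) y + exp_gauge' (θ m) x)
    + (cexp (θ m / 2 * I) * x + cexp (-(θ m / 2 * I)) * y) / 2 * Complex.sin_sq_add_cos_sq (z m)

/-- The antisymmetric vector has eigenvalue `sin² - cos² = -cos 2z`, the only place where the
disorder enters the recursion. -/
theorem antiPart_succ (z θ : ℤ → ℝ) (δ : ℝ) (m : ℤ) (n : ℕ) (h : θ (m + 1) = θ m + δ) :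
    antiPart z θ m (n + 1) = -Real.cos (2 * z m) *
      (Real.cos (δ / 2) * antiPart z θ (m + 1) n
        - I * Real.sin (δ / 2) * symPart z θ (m + 1) n) := by
  simp only [symPart, antiPart, transferIter, transfer_phaseObs_zero_zero,
    transfer_phaseObs_one_one, h]
  generalize transferIter z (fun j => phaseObs (θ j)) (m + 1) n 0 0 = x
  generalize transferIter z (fun j => phaseObs (θ j)) (m + 1) n 1 1 = y
  push_cast
  rw [add_div, Complex.cos_two_mul]
  linear_combination (2 * Complex.cos (z m) ^ 2 - 1)
      * (cos_sub_I_mul_sin_gauge' (θ m / 2) (δ / 2) x y) / 2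
    + Complex.cos (z m) ^ 2 / 2 * (exp_gauge (θ m) y - exp_gauge' (θ m) x)
    + (cexp (θ m / 2 * I) * x - cexp (-(θ m / 2 * I)) * y) / 2 * Complex.sin_sq_add_cos_sq (z m)

theorem antiPart_succ_norm_le (z θ : ℤ → ℝ) {δ : ℝ} (hδ : 0 ≤ δ) (m : ℤ) (n : ℕ)
    (h : θ (m + 1) = θ m + δ) :
    ‖antiPart z θ m (n + 1)‖ ≤ |Real.cos (2 * z m)| * (δ / 2 + ‖antiPart z θ (m + 1) n‖) := by
  rw [antiPart_succ z θ δ m n h, norm_mul, norm_neg, norm_real, Real.norm_eq_abs]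
  refine mul_le_mul_of_nonneg_left ((norm_sub_le _ _).trans ?_) (abs_nonneg _)
  rw [norm_mul, norm_mul, norm_mul, norm_I, one_mul, norm_real, norm_real, Real.norm_eq_abs,
    Real.norm_eq_abs, add_comm]
  have hs : |Real.sin (δ / 2)| ≤ δ / 2 := by
    have := Real.abs_sin_le_abs (x := δ / 2)
    rwa [abs_of_nonneg (by positivity : 0 ≤ δ / 2)] at this
  have := symPart_norm_le z θ (m + 1) n
  gcongr
  · calc _ ≤ δ / 2 * 1 := by gcongr
      _ = _ := mul_one _
  · exact mul_le_of_le_one_left (norm_nonneg _) (Real.abs_cos_le_one _)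

/-- The first-order term in `δ` is multiplied by the antisymmetric part, so an `O(δ)` bound on the
latter makes the whole increment second order. -/
theorem symPart_succ_sub_norm_le (z θ : ℤ → ℝ) {δ : ℝ} (hδ : 0 ≤ δ) (m : ℤ) (n : ℕ)
    (h : θ (m + 1) = θ m + δ) :
    ‖symPart z θ m (n + 1) - symPart z θ (m + 1) n‖
      ≤ δ ^ 2 / 8 + δ / 2 * ‖antiPart z θ (m + 1) n‖ := by
  have e : symPart z θ m (n + 1) - symPart z θ (m + 1) n
      = ((Real.cos (δ / 2) - 1 : ℝ) : ℂ) * symPart z θ (m + 1) n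
        - I * Real.sin (δ / 2) * antiPart z θ (m + 1) n := by
    rw [symPart_succ z θ δ m n h]
    push_cast
    ring
  have hs : |Real.sin (δ / 2)| ≤ δ / 2 := by
    have := Real.abs_sin_le_abs (x := δ / 2)
    rwa [abs_of_nonneg (by positivity : 0 ≤ δ / 2)] at this
  have hc : |Real.cos (δ / 2) - 1| ≤ δ ^ 2 / 8 := by
    rw [abs_sub_comm, abs_of_nonneg (sub_nonneg.2 (Real.cos_le_one _))]
    have := Real.one_sub_sq_div_two_le_cos (x := δ / 2)
    linarith
  rw [e]
  refine (norm_sub_le _ _).trans ?_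
  rw [norm_mul, norm_mul, norm_mul, norm_I, one_mul, norm_real, norm_real, Real.norm_eq_abs,
    Real.norm_eq_abs]
  have := symPart_norm_le z θ (m + 1) n
  gcongr
  calc _ ≤ δ ^ 2 / 8 * 1 := by gcongr
    _ = _ := mul_one _

/-- An empty chain still carries the gauge of `θ m`, here the angle one site beyond the right end.
The sign of the limit comes from this boundary value. -/
theorem symPart_zero (z θ : ℤ → ℝ) (m : ℤ) : symPart z θ m 0 = Real.cos (θ m / 2) := by
  simp [symPart, transferIter, Complex.cos]

theorem antiPart_zero (z θ : ℤ → ℝ) (m : ℤ) : antiPart z θ m 0 = I * Real.sin (θ m / 2) := by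
  simp [antiPart, transferIter, Complex.sin]
  linear_combination (cexp (θ m / 2 * I) - cexp (-(θ m / 2 * I))) / 2 * I_sq

theorem symPart_eq_trace (z θ : ℤ → ℝ) (m : ℤ) (n : ℕ) (h : θ m = 0) :
    symPart z θ m n = 1 / 2 * (transferIter z (fun j => phaseObs (θ j)) m n).trace := by
  simp [symPart, h, Matrix.trace_fin_two]
  ring

/-! ### The twist expectation: explicit form and measurability -/

/-- The step `2π / (2L + 1)` of the twist angle. -/
noncomputable def twistStep (L : ℕ) : ℝ := 2 * Real.pi / (2 * L + 1)

theorem akltState_twist (z : ℤ → ℝ) (L : ℕ) :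
    (akltState z).toCLM (twist L)
      -- The angle vanishes at the site `-L`, so the gauge there is trivial and the symmetric part
      -- is the normalized trace.
      = symPart z (fun j => (j + L) * twistStep L) (-(L : ℤ)) (2 * L + 2) := by
  rw [symPart_eq_trace _ _ _ _ (by simp), twist, akltState_pureTensor]
  congr 3
  funext j
  rw [← exp_smul_spinZ]
  congr 3
  rw [twistStep]
  push_cast
  ring

theorem measurable_transferIter (θ : ℤ → ℝ) (n : ℕ) : ∀ m : ℤ,
    Measurable (fun z => transferIter z (fun j => phaseObs (θ j)) m n 0 0) ∧
      Measurable (fun z => transferIter z (fun j => phaseObs (θ j)) m n 1 1) := by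
  induction n with
  | zero => intro m; exact ⟨measurable_const, measurable_const⟩
  | succ n ih =>
    intro m
    obtain ⟨h0, h1⟩ := ih (m + 1)
    simp only [transferIter, transfer_phaseObs_zero_zero, transfer_phaseObs_one_one]
    constructor <;> fun_prop

theorem measurable_symPart (θ : ℤ → ℝ) (m : ℤ) (n : ℕ) :
    Measurable fun z => symPart z θ m n := by
  obtain ⟨h0, h1⟩ := measurable_transferIter θ n m
  unfold symPart
  fun_prop

theorem measurable_antiPart (θ : ℤ → ℝ) (m : ℤ) (n : ℕ) :
    Measurable fun z => antiPart z θ m n := by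
  obtain ⟨h0, h1⟩ := measurable_transferIter θ n m
  unfold antiPart
  fun_prop

/-- The distance from `w` to its phase is `|1 - ‖w‖|`, which is at most `‖w + 1‖`; hence the factor
2. For `w = 0` the quotient is `0` and the claim reads `1 ≤ 2`. -/
theorem norm_phase_add_one_le (w : ℂ) : ‖w / (‖w‖ : ℂ) + 1‖ ≤ 2 * ‖w + 1‖ := by
  rcases eq_or_ne w 0 with rfl | hw
  · norm_num
  have hn : (‖w‖ : ℂ) ≠ 0 := by simpa using hw
  have e : w / (‖w‖ : ℂ) + 1 = w / (‖w‖ : ℂ) * ((1 - ‖w‖ : ℝ) : ℂ) + (w + 1) := by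
    push_cast
    field_simp
    ring
  have h1 : ‖w / (‖w‖ : ℂ)‖ = 1 := by
    rw [norm_div, norm_real, norm_norm, div_self (norm_ne_zero_iff.2 hw)]
  have h2 : |1 - ‖w‖| ≤ ‖w + 1‖ := by
    have := abs_norm_sub_norm_le (-1) w
    rw [norm_neg, norm_one, ← neg_add', norm_neg, add_comm] at this
    exact this
  rw [e]
  refine (norm_add_le _ _).trans ?_
  rw [norm_mul, h1, one_mul, norm_real, Real.norm_eq_abs]
  linarith

/-! ### Mean bounds for independent angles -/

open MeasureTheory ProbabilityTheory
open scoped ENNReal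

theorem antiPart_succ_enorm_le (z θ : ℤ → ℝ) {δ : ℝ} (hδ : 0 ≤ δ) (m : ℤ) (n : ℕ)
    (h : θ (m + 1) = θ m + δ) :
    ‖antiPart z θ m (n + 1)‖ₑ
      ≤ ‖Real.cos (2 * z m)‖ₑ * (ENNReal.ofReal (δ / 2) + ‖antiPart z θ (m + 1) n‖ₑ) := by
  have := ENNReal.ofReal_le_ofReal (antiPart_succ_norm_le z θ hδ m n h)
  rwa [ENNReal.ofReal_mul (abs_nonneg _), ENNReal.ofReal_add (by positivity) (norm_nonneg _),
    ofReal_norm, ofReal_norm, ← Real.norm_eq_abs, ofReal_norm] at this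

theorem symPart_succ_sub_enorm_le (z θ : ℤ → ℝ) {δ : ℝ} (hδ : 0 ≤ δ) (m : ℤ) (n : ℕ)
    (h : θ (m + 1) = θ m + δ) :
    ‖symPart z θ m (n + 1) - symPart z θ (m + 1) n‖ₑ
      ≤ ENNReal.ofReal (δ ^ 2 / 8) + ENNReal.ofReal (δ / 2) * ‖antiPart z θ (m + 1) n‖ₑ := by
  have := ENNReal.ofReal_le_ofReal (symPart_succ_sub_norm_le z θ hδ m n h)
  rwa [ENNReal.ofReal_add (by positivity) (by positivity), ENNReal.ofReal_mul (by positivity),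
    ofReal_norm, ofReal_norm] at this

/-- The state is obtained by choice, so measurability in the angles rests on the explicit formula
for its value on the twist. -/
theorem measurable_akltState_twist (L : ℕ) :
    Measurable fun z => (akltState z).toCLM (twist L) := by
  rw [funext fun z => akltState_twist z L]
  exact measurable_symPart _ _ _

variable {Ω : Type*} [MeasurableSpace Ω] {P : Measure Ω} {Θ : ℤ → Ω → ℝ}

/-- The constant `C` bounds the initial value (`hM`) and is preserved by the averaged recursion `c ↦
ρ (δ/2 + c)` (`hC`). The weight over sites `S` to the left of `m` strengthens the induction: each
step only adds a factor to the product, so independence is needed just for products of cosines and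
never for the antisymmetric part itself. -/
theorem lintegral_prod_mul_antiPart_le [IsProbabilityMeasure P] (hmeas : ∀ j, Measurable (Θ j))
    (hindep : iIndepFun Θ P) {ρ C : ℝ≥0∞}
    (hρ : ∀ j, ∫⁻ ω, ‖Real.cos (2 * Θ j ω)‖ₑ ∂P = ρ) {θ : ℤ → ℝ} {δ : ℝ} (hδ : 0 ≤ δ)
    (hθ : ∀ j, θ (j + 1) = θ j + δ) {M : ℤ}
    (hM : ‖Real.sin (θ M / 2)‖ₑ ≤ C) (hC : ρ * (ENNReal.ofReal (δ / 2) + C) ≤ C) (n : ℕ) :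
    ∀ (m : ℤ) (S : Finset ℤ), m + n = M → (∀ i ∈ S, i < m) →
      ∫⁻ ω, (∏ i ∈ S, ‖Real.cos (2 * Θ i ω)‖ₑ) * ‖antiPart (fun j => Θ j ω) θ m n‖ₑ ∂P
        ≤ ρ ^ S.card * C := by
  have hprod : ∀ S : Finset ℤ, ∫⁻ ω, ∏ i ∈ S, ‖Real.cos (2 * Θ i ω)‖ₑ ∂P = ρ ^ S.card := by
    intro S
    rw [lintegral_prod_eq_prod_lintegral_of_indepFun S
      (fun i ω => ‖Real.cos (2 * Θ i ω)‖ₑ)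
      (hindep.comp (fun _ x => ‖Real.cos (2 * x)‖ₑ) (fun _ => by fun_prop))
      (fun i => by have := hmeas i; fun_prop)]
    simp [hρ]
  have hGm : ∀ S : Finset ℤ, Measurable fun ω => ∏ i ∈ S, ‖Real.cos (2 * Θ i ω)‖ₑ := fun S =>
    Finset.measurable_fun_prod _ fun i _ => by have := hmeas i; fun_prop
  induction n with
  | zero =>
    intro m S h _
    obtain rfl : m = M := by simpa using h
    simp only [antiPart_zero]
    rw [lintegral_mul_const _ (hGm S), hprod]
    refine mul_le_mul_right ?_ _
    rwa [← ofReal_norm, norm_mul, norm_I, one_mul, norm_real, ofReal_norm]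
  | succ n ih =>
    intro m S h hS
    have hmS : m ∉ S := fun hm => lt_irrefl _ (hS m hm)
    -- The factor `|cos 2Θ_m|` released by the recursion joins the weight.
    have key := ih (m + 1) (insert m S) (by push_cast at h; linarith) (by
      intro i hi
      rcases Finset.mem_insert.1 hi with rfl | hi
      · linarith
      · linarith [hS i hi])
    calc _ ≤ ∫⁻ ω, ((∏ i ∈ insert m S, ‖Real.cos (2 * Θ i ω)‖ₑ) * ENNReal.ofReal (δ / 2)
          + (∏ i ∈ insert m S, ‖Real.cos (2 * Θ i ω)‖ₑ)
            * ‖antiPart (fun j => Θ j ω) θ (m + 1) n‖ₑ) ∂P := by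
          refine lintegral_mono fun ω => ?_
          simp only [Finset.prod_insert hmS]
          rw [← mul_add, mul_comm ‖Real.cos (2 * Θ m ω)‖ₑ, mul_assoc]
          exact mul_le_mul_right (antiPart_succ_enorm_le (fun j => Θ j ω) θ hδ m n (hθ m)) _
      _ = ρ ^ (S.card + 1) * ENNReal.ofReal (δ / 2) + ∫⁻ ω,
            (∏ i ∈ insert m S, ‖Real.cos (2 * Θ i ω)‖ₑ)
            * ‖antiPart (fun j => Θ j ω) θ (m + 1) n‖ₑ ∂P := by
          rw [lintegral_add_left ((hGm _).mul_const _), lintegral_mul_const _ (hGm _), hprod,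
            Finset.card_insert_of_notMem hmS]
      _ ≤ ρ ^ (S.card + 1) * ENNReal.ofReal (δ / 2) + ρ ^ (S.card + 1) * C := by
          rw [Finset.card_insert_of_notMem hmS] at key
          gcongr
      _ = ρ ^ S.card * (ρ * (ENNReal.ofReal (δ / 2) + C)) := by ring
      _ ≤ _ := mul_le_mul_right hC _

/-- Telescoping over the sites: every step costs `δ²/8` plus `δ/2` times the mean antisymmetric
part, which the weighted bound with empty weight controls by `C`. -/
theorem lintegral_symPart_sub_le [IsProbabilityMeasure P] (hmeas : ∀ j, Measurable (Θ j))
    (hindep : iIndepFun Θ P) {ρ C : ℝ≥0∞}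
    (hρ : ∀ j, ∫⁻ ω, ‖Real.cos (2 * Θ j ω)‖ₑ ∂P = ρ) {θ : ℤ → ℝ} {δ : ℝ} (hδ : 0 ≤ δ)
    (hθ : ∀ j, θ (j + 1) = θ j + δ) {M : ℤ}
    (hM : ‖Real.sin (θ M / 2)‖ₑ ≤ C) (hC : ρ * (ENNReal.ofReal (δ / 2) + C) ≤ C) (n : ℕ) :
    ∀ m : ℤ, m + n = M →
      ∫⁻ ω, ‖symPart (fun j => Θ j ω) θ m n - Real.cos (θ M / 2)‖ₑ ∂P
        ≤ n * (ENNReal.ofReal (δ ^ 2 / 8) + ENNReal.ofReal (δ / 2) * C) := by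
  have hz : Measurable fun ω j => Θ j ω := measurable_pi_lambda _ hmeas
  induction n with
  | zero =>
    intro m h
    obtain rfl : m = M := by simpa using h
    simp [symPart_zero]
  | succ n ih =>
    intro m h
    have hm : m + 1 + n = M := by push_cast at h; linarith
    have hanti := lintegral_prod_mul_antiPart_le hmeas hindep hρ hδ hθ hM hC n (m + 1) ∅ hm
      (by simp)
    simp only [Finset.prod_empty, one_mul, Finset.card_empty, pow_zero] at hanti
    have hq : Measurable fun ω => ‖antiPart (fun j => Θ j ω) θ (m + 1) n‖ₑ :=
      ((measurable_antiPart θ (m + 1) n).comp hz).enorm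
    calc _ ≤ ∫⁻ ω, ((ENNReal.ofReal (δ ^ 2 / 8)
            + ENNReal.ofReal (δ / 2) * ‖antiPart (fun j => Θ j ω) θ (m + 1) n‖ₑ)
          + ‖symPart (fun j => Θ j ω) θ (m + 1) n - Real.cos (θ M / 2)‖ₑ) ∂P := by
          refine lintegral_mono fun ω => ?_
          rw [← sub_add_sub_cancel _ (symPart (fun j => Θ j ω) θ (m + 1) n)]
          refine (enorm_add_le _ _).trans ?_
          gcongr
          exact symPart_succ_sub_enorm_le _ θ hδ m n (hθ m)
      _ = (ENNReal.ofReal (δ ^ 2 / 8) + ENNReal.ofReal (δ / 2)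
            * ∫⁻ ω, ‖antiPart (fun j => Θ j ω) θ (m + 1) n‖ₑ ∂P)
          + ∫⁻ ω, ‖symPart (fun j => Θ j ω) θ (m + 1) n - Real.cos (θ M / 2)‖ₑ ∂P := by
          rw [lintegral_add_left (by fun_prop), lintegral_add_left (by fun_prop),
            lintegral_const_mul _ hq, lintegral_const, measure_univ, mul_one]
      _ ≤ (ENNReal.ofReal (δ ^ 2 / 8) + ENNReal.ofReal (δ / 2) * C)
          + n * (ENNReal.ofReal (δ ^ 2 / 8) + ENNReal.ofReal (δ / 2) * C) := by
          gcongr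
          exact ih (m + 1) hm
      _ = _ := by push_cast; ring

/-! ### The mean contraction factor -/

theorem abs_cos_two_mul_lt_one {x : ℝ}
    (hx : x ∈ Set.Ioo 0 (Real.pi / 2) ∪ Set.Ioo (Real.pi / 2) Real.pi) :
    |Real.cos (2 * x)| < 1 := by
  have hs : 0 < Real.sin x := by
    have := Real.pi_pos
    rcases hx with hx | hx
    · exact Real.sin_pos_of_pos_of_lt_pi hx.1 (by linarith [hx.2])
    · exact Real.sin_pos_of_pos_of_lt_pi (by linarith [hx.1]) hx.2
  have hc : Real.cos x ≠ 0 := by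
    have := Real.pi_pos
    rcases hx with hx | hx
    · exact (Real.cos_pos_of_mem_Ioo ⟨by linarith [hx.1], hx.2⟩).ne'
    · exact (Real.cos_neg_of_pi_div_two_lt_of_lt hx.1 (by linarith [hx.2])).ne
  have hc2 : 0 < Real.cos x ^ 2 := by positivity
  have hs2 : 0 < Real.sin x ^ 2 := by positivity
  rw [Real.cos_two_mul, abs_lt]
  constructor <;> linarith [Real.sin_sq_add_cos_sq x]

/-- A pointwise strict inequality almost everywhere suffices for a strict one in mean; the angles
need not stay uniformly away from `0`, `π/2` and `π`. -/
theorem lintegral_cos_two_mul_lt_one [IsProbabilityMeasure P]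
    (hrange : ∀ᵐ ω ∂P, Θ 0 ω ∈ Set.Ioo 0 (Real.pi / 2) ∪ Set.Ioo (Real.pi / 2) Real.pi) :
    ∫⁻ ω, ‖Real.cos (2 * Θ 0 ω)‖ₑ ∂P < 1 := by
  have hle : ∫⁻ ω, ‖Real.cos (2 * Θ 0 ω)‖ₑ ∂P ≤ ∫⁻ _, 1 ∂P := by
    refine lintegral_mono fun ω => ?_
    rw [← ofReal_norm, ENNReal.ofReal_le_one]
    exact Real.abs_cos_le_one _
  rw [lintegral_const, measure_univ, mul_one] at hle
  have := lintegral_strict_mono (μ := P) (f := fun ω => ‖Real.cos (2 * Θ 0 ω)‖ₑ) (g := 1)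
    (IsProbabilityMeasure.ne_zero P) aemeasurable_const (hle.trans_lt ENNReal.one_lt_top).ne (by
      filter_upwards [hrange] with ω hω
      rw [← ofReal_norm, Pi.one_apply, ENNReal.ofReal_lt_one]
      exact abs_cos_two_mul_lt_one hω)
  simpa using this

/-! ### The rate of convergence -/

theorem twistStep_nonneg (L : ℕ) : 0 ≤ twistStep L := by
  have := Real.pi_pos
  rw [twistStep]
  positivity

/-- The last twisted site `L + 1` has the angle `2π`, so the gauge one site further has half angle
`π + δ/2`. -/
theorem twistAngle_end (L : ℕ) :
    ((((L : ℤ) + 2 : ℤ) : ℝ) + L) * twistStep L / 2 = twistStep L / 2 + Real.pi := by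
  have : (2 * L + 1 : ℝ) ≠ 0 := by positivity
  rw [twistStep]
  push_cast
  field_simp
  ring

/-- The expected distance of the twist expectation from `-1` is of order `1 / L`. -/
theorem lintegral_twist_add_one_le [IsProbabilityMeasure P] (hmeas : ∀ j, Measurable (Θ j))
    (hindep : iIndepFun Θ P) {ρ : ℝ≥0∞}
    (hρ : ∀ j, ∫⁻ ω, ‖Real.cos (2 * Θ j ω)‖ₑ ∂P = ρ) (hlt : ρ < 1) (L : ℕ) :
    ∫⁻ ω, ‖(akltState fun j => Θ j ω).toCLM (twist L) + 1‖ₑ ∂P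
      ≤ ENNReal.ofReal ((2 * L + 3) * twistStep L ^ 2) * (1 + (1 - ρ)⁻¹) := by
  set δ := twistStep L with hδ_def
  have hδ : 0 ≤ δ := twistStep_nonneg L
  set e := ENNReal.ofReal (δ / 2) with he
  set R := (1 - ρ)⁻¹ with hR
  -- `R` is the sum of the geometric series in `ρ`; its fixed-point equation makes `e * R`
  -- admissible as the constant `C`.
  have hgeom : R = 1 + ρ * R := by
    have h1 : (1 - ρ) * R = 1 := ENNReal.mul_inv_cancel (tsub_pos_of_lt hlt).ne'
      (ENNReal.sub_ne_top ENNReal.one_ne_top)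
    calc R = ((1 - ρ) + ρ) * R := by rw [tsub_add_cancel_of_le hlt.le, one_mul]
      _ = _ := by rw [add_mul, h1]
  have hC : e * R = e + ρ * (e * R) := by
    conv_lhs => rw [hgeom]
    ring
  have hsin : ‖Real.sin (δ / 2)‖ₑ ≤ e := by
    rw [← ofReal_norm]
    refine ENNReal.ofReal_le_ofReal ?_
    have := Real.abs_sin_le_abs (x := δ / 2)
    rwa [abs_of_nonneg (by positivity : 0 ≤ δ / 2)] at this
  have hcos : ‖(1 : ℂ) - Real.cos (δ / 2)‖ₑ ≤ ENNReal.ofReal (δ ^ 2 / 8) := by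
    rw [← ofReal_norm]
    refine ENNReal.ofReal_le_ofReal ?_
    rw [← ofReal_one, ← ofReal_sub, norm_real, Real.norm_eq_abs,
      abs_of_nonneg (sub_nonneg.2 (Real.cos_le_one _))]
    have := Real.one_sub_sq_div_two_le_cos (x := δ / 2)
    linarith
  have main := lintegral_symPart_sub_le hmeas hindep hρ (θ := fun j => (j + L) * δ) hδ
    (fun j => by push_cast; ring) (M := L + 2) (C := e * R)
    (by
      rw [hδ_def, twistAngle_end, ← hδ_def, Real.sin_add_pi, enorm_neg]
      exact hsin.trans (hC ▸ le_self_add))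
    (by
      calc _ = ρ * e + ρ * (e * R) := mul_add _ _ _
        _ ≤ 1 * e + ρ * (e * R) := by gcongr
        _ = e * R := by rw [one_mul, ← hC])
    (2 * L + 2) (-(L : ℤ)) (by push_cast; ring)
  simp only [akltState_twist]
  rw [hδ_def, twistAngle_end, ← hδ_def, Real.cos_add_pi] at main
  -- The boundary value is `-cos(δ/2)` and not `-1`; the difference costs one more `δ²/8`, so the
  -- `2L + 2` steps and this correction give the factor `2L + 3`.
  calc _ ≤ ∫⁻ ω, (‖symPart (fun j => Θ j ω) (fun j => (j + L) * δ) (-(L : ℤ)) (2 * L + 2)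
            - ((-Real.cos (δ / 2) : ℝ) : ℂ)‖ₑ + ENNReal.ofReal (δ ^ 2 / 8)) ∂P := by
        refine lintegral_mono fun ω => ?_
        refine le_trans ?_ (add_le_add_right hcos _)
        refine le_trans (le_of_eq ?_) (enorm_add_le _ _)
        congr 1
        push_cast
        ring
    _ ≤ ((2 * L + 2 : ℕ) : ℝ≥0∞) * (ENNReal.ofReal (δ ^ 2 / 8) + e * (e * R))
          + ENNReal.ofReal (δ ^ 2 / 8) := by
        rw [lintegral_add_right _ measurable_const, lintegral_const, measure_univ, mul_one]
        gcongr
    _ ≤ ((2 * L + 2 : ℕ) : ℝ≥0∞) * (ENNReal.ofReal (δ ^ 2) * (1 + R))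
          + ENNReal.ofReal (δ ^ 2) * (1 + R) := by
        have h8 : ENNReal.ofReal (δ ^ 2 / 8) ≤ ENNReal.ofReal (δ ^ 2) :=
          ENNReal.ofReal_le_ofReal (by nlinarith)
        have h4 : e * e ≤ ENNReal.ofReal (δ ^ 2) := by
          rw [he, ← ENNReal.ofReal_mul (by positivity)]
          exact ENNReal.ofReal_le_ofReal (by nlinarith)
        rw [← mul_assoc e, mul_add _ 1, mul_one]
        gcongr
        exact h8.trans le_self_add
    _ = ENNReal.ofReal ((2 * L + 3) * δ ^ 2) * (1 + R) := by
        rw [ENNReal.ofReal_mul (by positivity), show (2 * L + 3 : ℝ) = ((2 * L + 3 : ℕ) : ℝ) by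
          push_cast; ring, ENNReal.ofReal_natCast]
        push_cast
        ring

theorem tendsto_twistStep_sq :
    Filter.Tendsto (fun L : ℕ => (2 * L + 3) * twistStep L ^ 2) Filter.atTop (nhds 0) := by
  -- The constant is `4π²` from the squared step times the `3` in `(2L + 3)(L + 1) ≤ 3(2L + 1)²`,
  -- which is an equality at `L = 0`.
  have h : Filter.Tendsto (fun L : ℕ => 12 * Real.pi ^ 2 * (1 / ((L : ℝ) + 1)))
      Filter.atTop (nhds 0) := by
    have := (tendsto_one_div_add_atTop_nhds_zero_nat (𝕜 := ℝ)).const_mul (12 * Real.pi ^ 2)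
    rwa [mul_zero] at this
  refine squeeze_zero (fun L => by positivity) (fun L => ?_) h
  have hL : (0 : ℝ) ≤ L := L.cast_nonneg
  rw [twistStep, div_pow, mul_div_assoc', mul_one_div, div_le_div_iff₀ (by positivity) (by positivity)]
  have : (2 * L + 3 : ℝ) * (L + 1) ≤ 3 * (2 * L + 1) ^ 2 := by nlinarith
  nlinarith [mul_le_mul_of_nonneg_left this (sq_nonneg Real.pi)]

end AKLT

theorem theorem4p28 {Ω : Type*} [MeasurableSpace Ω] (P : MeasureTheory.Measure Ω)
    [MeasureTheory.IsProbabilityMeasure P] (Θ : ℤ → Ω → ℝ)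
    (hmeas : ∀ j, Measurable (Θ j))
    (hindep : ProbabilityTheory.iIndepFun Θ P)
    (hident : ∀ j, ProbabilityTheory.IdentDistrib (Θ j) (Θ 0) P P)
    (hrange : ∀ᵐ ω ∂P, Θ 0 ω ∈ Set.Ioo 0 (Real.pi / 2) ∪ Set.Ioo (Real.pi / 2) Real.pi) :
    (∀ L : ℕ,
      MeasureTheory.MemLp (fun ω => (AKLT.akltState fun j => Θ j ω).toCLM (AKLT.twist L)) 1 P ∧
      MeasureTheory.MemLp (fun ω => AKLT.twistSign (AKLT.akltState fun j => Θ j ω) L) 1 P) ∧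
    Filter.Tendsto
      (fun L : ℕ => MeasureTheory.eLpNorm
        (fun ω => (AKLT.akltState fun j => Θ j ω).toCLM (AKLT.twist L) + 1) 1 P)
      Filter.atTop (nhds 0) ∧
    Filter.Tendsto
      (fun L : ℕ => MeasureTheory.eLpNorm
        (fun ω => AKLT.twistSign (AKLT.akltState fun j => Θ j ω) L + 1) 1 P)
      Filter.atTop (nhds 0) := by
  have hz : Measurable fun ω j => Θ j ω := measurable_pi_lambda _ hmeas
  have hν : ∀ L, Measurable fun ω => (AKLT.akltState fun j => Θ j ω).toCLM (AKLT.twist L) :=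
    fun L => (AKLT.measurable_akltState_twist L).comp hz
  have hρ : ∀ j, ∫⁻ ω, ‖Real.cos (2 * Θ j ω)‖ₑ ∂P = ∫⁻ ω, ‖Real.cos (2 * Θ 0 ω)‖ₑ ∂P := fun j =>
    ((hident j).comp (u := fun x => ‖Real.cos (2 * x)‖ₑ) (by fun_prop)).lintegral_eq
  have hlt := AKLT.lintegral_cos_two_mul_lt_one hrange
  have hlim : Filter.Tendsto
      (fun L : ℕ => MeasureTheory.eLpNorm
        (fun ω => (AKLT.akltState fun j => Θ j ω).toCLM (AKLT.twist L) + 1) 1 P)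
      Filter.atTop (nhds 0) := by
    simp only [MeasureTheory.eLpNorm_one_eq_lintegral_enorm]
    refine tendsto_of_tendsto_of_tendsto_of_le_of_le tendsto_const_nhds ?_ (fun _ => zero_le)
      (AKLT.lintegral_twist_add_one_le hmeas hindep hρ hlt)
    -- The prefactor `1 + (1 - ρ)⁻¹` is finite because `ρ < 1`, so the product with a null sequence
    -- tends to `0`.
    have := ENNReal.Tendsto.mul_const (ENNReal.tendsto_ofReal AKLT.tendsto_twistStep_sq)
      (b := 1 + (1 - ∫⁻ ω, ‖Real.cos (2 * Θ 0 ω)‖ₑ ∂P)⁻¹) (Or.inr (ENNReal.add_ne_top.2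
        ⟨ENNReal.one_ne_top, ENNReal.inv_ne_top.2 (tsub_pos_of_lt hlt).ne'⟩))
    simpa using this
  refine ⟨fun L => ⟨?_, ?_⟩, hlim, ?_⟩
  · refine MeasureTheory.MemLp.of_bound (hν L).aestronglyMeasurable 1 (.of_forall fun ω => ?_)
    rw [AKLT.akltState_twist]
    exact AKLT.symPart_norm_le _ _ _ _
  · refine MeasureTheory.MemLp.of_bound ?_ 1 (.of_forall fun ω => ?_)
    · have := hν L
      unfold AKLT.twistSign
      exact Measurable.aestronglyMeasurable (by fun_prop)
    · rw [AKLT.twistSign, norm_div, Complex.norm_real, norm_norm]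
      -- This also covers a vanishing expectation, where the quotient is `0`.
      exact div_self_le_one _
  · refine tendsto_of_tendsto_of_tendsto_of_le_of_le tendsto_const_nhds (h := fun L : ℕ =>
      2 * MeasureTheory.eLpNorm
        (fun ω => (AKLT.akltState fun j => Θ j ω).toCLM (AKLT.twist L) + 1) 1 P) ?_
      (fun _ => zero_le) (fun L => ?_)
    · simpa using ENNReal.Tendsto.const_mul hlim (a := 2) (Or.inr ENNReal.ofNat_ne_top)
    · simp only [MeasureTheory.eLpNorm_one_eq_lintegral_enorm]
      rw [← MeasureTheory.lintegral_const_mul _ ((hν L).add_const 1).enorm]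
      refine MeasureTheory.lintegral_mono fun ω => ?_
      have := ENNReal.ofReal_le_ofReal (AKLT.norm_phase_add_one_le
        ((AKLT.akltState fun j => Θ j ω).toCLM (AKLT.twist L)))
      rwa [ENNReal.ofReal_mul zero_le_two, ofReal_norm, ofReal_norm, ENNReal.ofReal_ofNat] at this
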